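/- All vector spaces are over $\mathbb{C}$. Let $(V,Y,D)$ be a vertex algebra without vacuum, i.e. a vector space $V$ with a linear map $Y(\cdot,x):V\to \mathrm{Hom}(V,V((x)))$, $Y(v,x)=\sum_{n\in\mathbb{Z}}v_nx^{-n-1}$, and a linear operator $D$ on $V$ such that for all $u,v\in V$ the Jacobi identity $$x_0^{-1}\delta\left(\tfrac{x_1-x_2}{x_0}\right)Y(u,x_1)Y(v,x_2)-x_0^{-1}\delta\left(\tfrac{x_2-x_1}{-x_0}\right)Y(v,x_2)Y(u,x_1)=x_2^{-1}\delta\left(\tfrac{x_1-x_0}{x_2}\right)Y(Y(u,x_0)v,x_2),$$ the $D$-derivative property $Y(Dv,x)=\frac{d}{dx}Y(v,x)$, and skew symmetry $Y(u,x)v=e^{xD}Y(v,-x)u$ hold. Let $\overline V=V\oplus\mathbb{C}\mathbf 1$, where $\mathbb{C}\mathbf 1$ is a one-dimensional space with basis vector $\mathbf 1$. Then: 1. There is a unique linear map $\overline Y(\cdot,x):\overline V\to\mathrm{Hom}(\overline V,\overline V((x)))$ with $\overline Y(\mathbf 1,x)=1$ and $\overline Y(u,x)(v+\lambda\mathbf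 1)=Y(u,x)v+\lambda e^{xD}u$ for $u,v\in V$, $\lambda\in\mathbb{C}$. 2. $(\overline V,\overline Y,\mathbf 1)$ is a vertex algebra; that is, $\overline Y(\mathbf 1,x)v=v$, $\overline Y(v,x)\mathbf 1\in\overline V[[x]]$ with $\lim_{x\to0}\overline Y(v,x)\mathbf 1=v$ for all $v\in\overline V$, and the Jacobi identity holds for $\overline Y$. With its canonical operator $\mathcal D v=v_{-2}\mathbf 1$ it is a vertex algebra without vacuum, and it contains $V$ as a vertex subalgebra without vacuum: the inclusion $\iota:V\to\overline V$ satisfies $\iota(Du)=\mathcal D\iota(u)$ and $\iota(Y(u,x)v)=\overline Y(\iota(u),x)\iota(v)$ for all $u,v\in V$. 3. Consequently $V$ has a faithful module: there are a vector space $W$ and an injective linear map $Y_W(\cdot,x):V\to\mathrm{Hom}(W,W((x)))$ such that $Y_W(Dv,x)=\frac{d}{dx}Y_W(v,x)$ for all $v\in V$ and, for all $u,v\in V$, $$x_0^{-1}\delta\left(\tfrac{x_1-x_2}{x_0}\right)Y_W(u,x_1)Y_W(v,x_2)-x_0^{-1}\delta\left(\tfrac{x_2-x_1}{-x_0}\right)Y_W(v,x_2)Y_W(u,x_1)=x_2^{-1}\delta\left(\tfrac{x_1-x_0}{x_2}\right)Y_W(Y(u,x_0)v,x_2).$$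 Here $\delta(x)=\sum_{k\in\mathbb{Z}}x^k$ and powers of binomials are expanded in nonnegative powers of the second variable. -/

import Mathlib

universe u

namespace VertexAlg

/-! All vector spaces are over `ℂ`. For a vector space `W`, Mathlib's `VertexOperator ℂ W` is the
space `Hom(W, W((x)))` of linear maps from `W` to Laurent series (with finitely many negative
powers of `x`) with coefficients in `W`. A linear map `Y(·, x) : V → Hom(W, W((x)))` is an element
of `V →ₗ[ℂ] VertexOperator ℂ W`. -/

/-- The mode `u_n ∈ End W` of `Y(u, x) = ∑_{n ∈ ℤ} u_n x^{-n-1}`. -/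
noncomputable def mode {V W : Type*} [AddCommGroup V] [Module ℂ V] [AddCommGroup W] [Module ℂ W]
    (Y : V →ₗ[ℂ] VertexOperator ℂ W) (u : V) (n : ℤ) : Module.End ℂ W :=
  VertexOperator.ncoeff (Y u) n

/-- The Jacobi identity
`x₀⁻¹ δ((x₁ - x₂)/x₀) Y_W(u, x₁) Y_W(v, x₂) - x₀⁻¹ δ((x₂ - x₁)/(-x₀)) Y_W(v, x₂) Y_W(u, x₁)`
`= x₂⁻¹ δ((x₁ - x₀)/x₂) Y_W(Y(u, x₀) v, x₂)`,
applied to `w`, as the equality of the coefficients of `x₀^{-l-1} x₁^{-m-1} x₂^{-n-1}` on both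
sides for all integers `l, m, n`.  Here `δ(x) = ∑_{k ∈ ℤ} x^k`, and every power of a binomial is
expanded in nonnegative powers of its second variable:
`x₀⁻¹ δ((x₁ - x₂)/x₀) = ∑_{l ∈ ℤ} ∑_{i ≥ 0} (-1)^i C(l, i) x₀^{-l-1} x₁^{l-i} x₂^i`,
`x₀⁻¹ δ((x₂ - x₁)/(-x₀)) = ∑_{l ∈ ℤ} ∑_{i ≥ 0} (-1)^{l+i} C(l, i) x₀^{-l-1} x₂^{l-i} x₁^i`,
`x₂⁻¹ δ((x₁ - x₀)/x₂) = ∑_{m ∈ ℤ} ∑_{i ≥ 0} C(m, i) x₀^i x₁^{-m-1} x₂^{m-i}`.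
(In the last one, the exponent of the binomial is `i - m - 1` and `(-1)^i C(i - m - 1, i) = C(m, i)`.)
All three sums over `i` have only finitely many nonzero terms, since `Y` and `Y_W` take values in
Laurent series.  The identity for `V` itself is the case `W = V`, `Y_W = Y`. -/
def JacobiIdentity {V W : Type*} [AddCommGroup V] [Module ℂ V] [AddCommGroup W] [Module ℂ W]
    (Y : V →ₗ[ℂ] VertexOperator ℂ V) (YW : V →ₗ[ℂ] VertexOperator ℂ W) : Prop :=
  ∀ (u v : V) (w : W) (l m n : ℤ),
    (∑ᶠ i : ℕ, ((-1 : ℂ) ^ i * (Ring.choose l i : ℤ)) •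
        mode YW u (m + l - i) (mode YW v (n + i) w)) -
      (∑ᶠ i : ℕ, ((-1 : ℂ) ^ (l + i) * (Ring.choose l i : ℤ)) •
        mode YW v (n + l - i) (mode YW u (m + i) w)) =
    ∑ᶠ i : ℕ, ((Ring.choose m i : ℤ) : ℂ) • mode YW (mode Y u (l + i) v) (m + n - i) w

/-- The `D`-derivative property `Y(D v, x) = (d/dx) Y(v, x)`, i.e. `(D v)_n = -n v_{n-1}`. -/
def DDerivative {V W : Type*} [AddCommGroup V] [Module ℂ V] [AddCommGroup W] [Module ℂ W]
    (YW : V →ₗ[ℂ] VertexOperator ℂ W) (D : Module.End ℂ V) : Prop :=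
  ∀ (v : V) (n : ℤ), mode YW (D v) n = (-n : ℂ) • mode YW v (n - 1)

/-- Skew symmetry `Y(u, x) v = e^{xD} Y(v, -x) u`, compared at `x^{-n-1}`:
`u_n v = ∑_{j ≥ 0} (-1)^{n+j+1} (1/j!) D^j (v_{n+j} u)`, a sum with finitely many nonzero terms. -/
def SkewSymmetry {V : Type*} [AddCommGroup V] [Module ℂ V]
    (Y : V →ₗ[ℂ] VertexOperator ℂ V) (D : Module.End ℂ V) : Prop :=
  ∀ (u v : V) (n : ℤ), mode Y u n v =
    ∑ᶠ j : ℕ, ((-1 : ℂ) ^ (n + j + 1) * (j.factorial : ℂ)⁻¹) • (D ^ j) (mode Y v (n + j) u)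

/-- `(V, Y, one)` is a vertex algebra. -/
structure IsVertexAlgebra {V : Type*} [AddCommGroup V] [Module ℂ V]
    (Y : V →ₗ[ℂ] VertexOperator ℂ V) (one : V) : Prop where
  /-- `Y(1, x) v = v` -/
  vacuum : ∀ (v : V) (n : ℤ), mode Y one n v = if n = -1 then v else 0
  /-- `Y(v, x) 1` has no negative powers of `x` -/
  creation_regular : ∀ (v : V) (n : ℤ), 0 ≤ n → mode Y v n one = 0
  /-- the constant term of `Y(v, x) 1` is `v` -/
  creation_limit : ∀ v : V, mode Y v (-1) one = v
  jacobi : JacobiIdentity Y Y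

/-- `(V, Y, D)` is a vertex algebra without vacuum. -/
structure IsVertexAlgebraWithoutVacuum {V : Type*} [AddCommGroup V] [Module ℂ V]
    (Y : V →ₗ[ℂ] VertexOperator ℂ V) (D : Module.End ℂ V) : Prop where
  jacobi : JacobiIdentity Y Y
  derivative : DDerivative Y D
  skew : SkewSymmetry Y D

/-- The canonical operator `𝒟 v = v_{-2} 1` of a vertex algebra. -/
noncomputable def canonicalD {V : Type*} [AddCommGroup V] [Module ℂ V]
    (Y : V →ₗ[ℂ] VertexOperator ℂ V) (one : V) : Module.End ℂ V where
  toFun v := mode Y v (-2) one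
  map_add' a b := by simp [mode]
  map_smul' c a := by simp [mode]

/-- `ψ` is a homomorphism `(U, Y_U, D_U) → (V, Y_V, D_V)` of vertex algebras without vacuum:
`ψ(D u) = D ψ(u)` and `ψ(Y(u, x) u') = Y(ψ(u), x) ψ(u')`. -/
def IsHomWithoutVacuum {U V : Type*} [AddCommGroup U] [Module ℂ U] [AddCommGroup V] [Module ℂ V]
    (YU : U →ₗ[ℂ] VertexOperator ℂ U) (DU : Module.End ℂ U)
    (YV : V →ₗ[ℂ] VertexOperator ℂ V) (DV : Module.End ℂ V) (ψ : U →ₗ[ℂ] V) : Prop :=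
  (∀ u : U, ψ (DU u) = DV (ψ u)) ∧
    ∀ (u u' : U) (n : ℤ), ψ (mode YU u n u') = mode YV (ψ u) n (ψ u')

/-- `(W, Y_W)` is a module for the vertex algebra without vacuum `(V, Y, D)`. -/
structure IsModuleWithoutVacuum {V W : Type*} [AddCommGroup V] [Module ℂ V]
    [AddCommGroup W] [Module ℂ W] (Y : V →ₗ[ℂ] VertexOperator ℂ V) (D : Module.End ℂ V)
    (YW : V →ₗ[ℂ] VertexOperator ℂ W) : Prop where
  jacobi : JacobiIdentity Y YW
  derivative : DDerivative YW D

/-- The coefficient of `x^{-n-1}` in `e^{xD} u = ∑_{j ≥ 0} (1/j!) (D^j u) x^j`. -/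
noncomputable def expMode {V : Type*} [AddCommGroup V] [Module ℂ V]
    (D : Module.End ℂ V) (u : V) (n : ℤ) : V :=
  if n < 0 then ((-n - 1).toNat.factorial : ℂ)⁻¹ • (D ^ (-n - 1).toNat) u else 0

/-- The space `V ⊕ ℂ1` is `V × ℂ`, with `(v, c)` in the role of `v + c1`; so `1` is `(0, 1)` and
`u ∈ V` is `(u, 0)`.  The linear map `Ȳ` is given by `Ȳ(1, x) = 1` and
`Ȳ(u, x)(v + c1) = Y(u, x) v + c e^{xD} u`. -/
structure IsVacuumExtension {V : Type*} [AddCommGroup V] [Module ℂ V]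
    (Y : V →ₗ[ℂ] VertexOperator ℂ V) (D : Module.End ℂ V)
    (Ybar : (V × ℂ) →ₗ[ℂ] VertexOperator ℂ (V × ℂ)) : Prop where
  on_one : ∀ (w : V × ℂ) (n : ℤ), mode Ybar (0, 1) n w = if n = -1 then w else 0
  on_left : ∀ (u v : V) (c : ℂ) (n : ℤ),
    mode Ybar (u, 0) n (v, c) = (mode Y u n v + c • expMode D u n, 0)

end VertexAlg

/-! `Ȳ` is fixed by its values on `V` and on `1`, so existence and uniqueness are formal. The
substance is the Jacobi identity for `Ȳ`. By linearity each of the three vectors may be taken in `V`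
or equal to `1`.

If one of the operators is that of `1`, every sum has a closed form: the identity becomes the one
between the three delta functions (`intChoose_delta`), helped by Vandermonde when `1` is the second
vector, where `Y(e^{x₀D}u, x₂) = Y(u, x₂ + x₀)` enters (`mode_expMode`). If all three vectors lie in
`V`, it is the hypothesis.

What remains is `u, v ∈ V` acting on `1`, an identity between `Y(u, x₁)e^{x₂D}v`, `Y(v, x₂)e^{x₁D}u`
and `e^{x₂D}Y(u, x₀)v`. Let `F(l, m, n)` be the difference of its two sides. Multiplication by `x₀ =
x₁ - x₂` gives `F(l+1, m, n) = F(l, m+1, n) - F(l, m, n+1)`; since `D` is a derivation of all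
products, `D F(l, m, n) = -m F(l, m-1, n) - n F(l, m, n-1)`. These recursions spread the vanishing
from a few values, where it is skew symmetry or trivial, to all `(l, m, n)`
(`jacobiDefect_eq_zero`).

The faithful module is `V̄` itself, restricted to `V`: `u` is recovered as `u_{-1}1`. -/

namespace VertexAlg

open Filter

/-! ### Binomial coefficients and finite binomial sums -/

section BinomialSums

variable {W : Type*} [AddCommGroup W] [Module ℂ W]

/-- The binomial coefficient `C(r, k)` for integers `r` and `k`, zero for negative `k`. -/
def intChoose (r k : ℤ) : ℤ := if 0 ≤ k then Ring.choose r k.toNat else 0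

theorem intChoose_natCast (r : ℤ) (k : ℕ) : intChoose r k = Ring.choose r k := by
  simp [intChoose]

theorem intChoose_of_neg (r : ℤ) {k : ℤ} (hk : k < 0) : intChoose r k = 0 := by
  simp [intChoose, not_le.mpr hk]

theorem neg_one_zpow_mul_self (k : ℤ) : (-1 : ℂ) ^ k * (-1 : ℂ) ^ k = 1 := by
  rw [← mul_zpow]; simp

theorem intChoose_neg (r k : ℤ) :
    (-1 : ℂ) ^ k * intChoose r k = intChoose (k - r - 1) k := by
  rcases lt_or_ge k 0 with hk | hk
  · simp [intChoose_of_neg _ hk]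
  · lift k to ℕ using hk
    have h := Ring.choose_neg (-r) k
    rw [neg_neg] at h
    rw [intChoose_natCast, intChoose_natCast, h,
      show -r + (k : ℤ) - 1 = (k : ℤ) - r - 1 by ring, Units.smul_def, Int.coe_negOnePow_natCast,
      zpow_natCast]
    rw [smul_eq_mul]
    push_cast
    rw [← mul_assoc, ← mul_pow]
    simp

theorem intChoose_symm {r : ℤ} (hr : 0 ≤ r) (k : ℤ) : intChoose r k = intChoose r (r - k) := by
  lift r to ℕ using hr
  rcases lt_or_ge k 0 with hk | hk
  · rw [intChoose_of_neg _ hk]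
    obtain ⟨j, hj⟩ := Int.eq_ofNat_of_zero_le (show 0 ≤ (r : ℤ) - k by omega)
    rw [hj, intChoose_natCast, Ring.choose_natCast, Nat.choose_eq_zero_of_lt (by omega)]; rfl
  · lift k to ℕ using hk
    rcases lt_or_ge r k with h | h
    · rw [intChoose_of_neg _ (show (r : ℤ) - k < 0 by omega), intChoose_natCast, Ring.choose_natCast,
        Nat.choose_eq_zero_of_lt h]; rfl
    · rw [← Nat.cast_sub h, intChoose_natCast, intChoose_natCast, Ring.choose_natCast,
        Ring.choose_natCast, Nat.choose_symm h]

/-- The coefficient form of the delta function identity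
`x₀⁻¹ δ((x₁ - x₂)/x₀) - x₀⁻¹ δ((x₂ - x₁)/(-x₀)) = x₂⁻¹ δ((x₁ - x₀)/x₂)`. -/
theorem intChoose_delta (l m : ℤ) :
    (-1 : ℂ) ^ (m + l + 1) * intChoose l (m + l + 1) -
      (-1 : ℂ) ^ l * ((-1 : ℂ) ^ (-1 - m) * intChoose l (-1 - m)) = intChoose m (-l - 1) := by
  rcases le_or_gt 0 l with hl | hl
  -- For `l ≥ 0` both expansions are the polynomial `(x₁ - x₂)^l`, so they cancel. For `l < 0` one
  -- of them contributes nothing, according to the sign of `m`.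
  · rw [intChoose_symm hl (m + l + 1), show l - (m + l + 1) = -1 - m by ring,
      intChoose_of_neg m (show -l - 1 < 0 by omega), ← mul_assoc, ← zpow_add₀ (by norm_num),
      show m + l + 1 = (l + (-1 - m)) + 2 * (m + 1) by ring, zpow_add₀ (by norm_num), zpow_mul]
    simp
  · rcases le_or_gt 0 m with hm | hm
    · rw [intChoose_neg, intChoose_of_neg l (show -1 - m < 0 by omega),
        show m + l + 1 - l - 1 = m by ring, intChoose_symm hm,
        show m - (m + l + 1) = -l - 1 by ring]
      simp
    · have h := intChoose_neg m (-l - 1)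
      rw [intChoose_of_neg l (show m + l + 1 < 0 by omega), intChoose_neg,
        show -1 - m - l - 1 = -l - m - 2 by ring, intChoose_symm (by omega)]
      rw [show -l - 1 - m - 1 = -l - m - 2 by ring] at h
      rw [show -l - m - 2 - (-1 - m) = -l - 1 by ring, ← h, ← mul_assoc, ← zpow_add₀ (by norm_num),
        show l + (-l - 1) = -1 by ring]
      simp

/-- `∑_{i ≥ 0} ε^i C(l, i) F_i`. -/
noncomputable def binomSum (ε : ℂ) (l : ℤ) (F : ℕ → W) : W :=
  ∑ᶠ i : ℕ, (ε ^ i * (Ring.choose l i : ℤ)) • F i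

theorem finsum_eq_sum_range {W : Type*} [AddCommMonoid W] {F : ℕ → W} {N : ℕ} (h : ∀ i ≥ N, F i = 0) :
    ∑ᶠ i, F i = ∑ i ∈ Finset.range N, F i := by
  refine finsum_eq_sum_of_support_subset _ fun i hi => ?_
  by_contra hN
  exact hi (h i (by simpa using hN))

theorem binomSum_eq_sum_range (ε : ℂ) (l : ℤ) {F : ℕ → W} {N : ℕ} (h : ∀ i ≥ N, F i = 0) :
    binomSum ε l F = ∑ i ∈ Finset.range N, (ε ^ i * (Ring.choose l i : ℤ)) • F i :=
  finsum_eq_sum_range fun i hi => by rw [h i hi, smul_zero]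

theorem binomSum_add (ε : ℂ) (l : ℤ) {F G : ℕ → W} (hF : ∀ᶠ i in atTop, F i = 0)
    (hG : ∀ᶠ i in atTop, G i = 0) :
    binomSum ε l (fun i => F i + G i) = binomSum ε l F + binomSum ε l G := by
  obtain ⟨N, hN⟩ := eventually_atTop.mp (hF.and hG)
  rw [binomSum_eq_sum_range ε l fun i hi => (hN i hi).1,
    binomSum_eq_sum_range ε l fun i hi => (hN i hi).2, binomSum_eq_sum_range ε l (N := N)
      fun i hi => by rw [(hN i hi).1, (hN i hi).2, add_zero], ← Finset.sum_add_distrib]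
  simp only [smul_add]

theorem binomSum_smul (ε : ℂ) (l : ℤ) (c : ℂ) (F : ℕ → W) :
    binomSum ε l (fun i => c • F i) = c • binomSum ε l F := by
  simp only [binomSum, smul_finsum, smul_comm c]

theorem map_binomSum {W' : Type*} [AddCommGroup W'] [Module ℂ W'] (φ : W →ₗ[ℂ] W') (ε : ℂ) (l : ℤ)
    {F : ℕ → W} (hF : ∀ᶠ i in atTop, F i = 0) :
    φ (binomSum ε l F) = binomSum ε l (fun i => φ (F i)) := by
  obtain ⟨N, hN⟩ := eventually_atTop.mp hF
  rw [binomSum_eq_sum_range ε l hN,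
    binomSum_eq_sum_range ε l (N := N) fun i hi => by rw [hN i hi, map_zero]]
  simp only [map_sum, map_smul]

/-- Pascal's rule. Eventual vanishing matters because `finsum` returns `0` on infinite support. -/
theorem binomSum_succ (ε : ℂ) (l : ℤ) {F : ℕ → W} (hF : ∀ᶠ i in atTop, F i = 0) :
    binomSum ε (l + 1) F = binomSum ε l F + ε • binomSum ε l (fun i => F (i + 1)) := by
  obtain ⟨N, hN⟩ := eventually_atTop.mp hF
  rw [binomSum_eq_sum_range ε l (N := N + 1) fun i hi => hN i (by omega),
    binomSum_eq_sum_range ε (l + 1) (N := N + 1) fun i hi => hN i (by omega),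
    binomSum_eq_sum_range ε l (N := N) fun i hi => hN (i + 1) (by omega),
    Finset.sum_range_succ', Finset.sum_range_succ', Finset.smul_sum, add_right_comm,
    ← Finset.sum_add_distrib]
  congr 1
  · refine Finset.sum_congr rfl fun i _ => ?_
    rw [Ring.choose_succ_succ, smul_smul, ← add_smul]
    congr 1
    push_cast
    ring
  · simp

theorem succ_mul_choose_succ (l : ℤ) (i : ℕ) :
    ((i : ℤ) + 1) * Ring.choose l (i + 1) = (l - i) * Ring.choose l i := by
  have h := Ring.choose_smul_choose l (show i ≤ i + 1 by omega)
  rw [Nat.choose_succ_self_right, Nat.add_sub_cancel_left, Ring.choose_one_right, nsmul_eq_mul] at h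
  push_cast at h
  rw [h, mul_comm]

theorem sub_mul_choose (l : ℤ) (i : ℕ) :
    (l - i) * Ring.choose l i = l * Ring.choose (l - 1) i := by
  have h := Ring.choose_smul_choose l (show 1 ≤ i + 1 by omega)
  rw [Nat.choose_one_right, Nat.add_sub_cancel, Ring.choose_one_right, nsmul_eq_mul] at h
  push_cast at h
  rw [← succ_mul_choose_succ, h]

theorem binomSum_natCast_smul (ε : ℂ) (l : ℤ) {G : ℕ → W} (hG : ∀ᶠ i in atTop, G i = 0) :
    binomSum ε l (fun i => (i : ℂ) • G i) =
      ε • binomSum ε l (fun i => ((l : ℂ) - i) • G (i + 1)) := by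
  obtain ⟨N, hN⟩ := eventually_atTop.mp hG
  rw [binomSum_eq_sum_range ε l (N := N + 1) fun i hi => by rw [hN i (by omega), smul_zero],
    binomSum_eq_sum_range ε l (N := N) fun i hi => by rw [hN (i + 1) (by omega), smul_zero],
    Finset.sum_range_succ', Finset.smul_sum]
  simp only [Nat.cast_zero, zero_smul, smul_zero, add_zero, smul_smul]
  refine Finset.sum_congr rfl fun i _ => ?_
  congr 1
  have h : ((i : ℂ) + 1) * (Ring.choose l (i + 1) : ℤ) = (l - i) * (Ring.choose l i : ℤ) := by
    exact_mod_cast succ_mul_choose_succ l i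
  push_cast
  linear_combination ε ^ (i + 1) * h

theorem binomSum_sub_smul (ε : ℂ) (l : ℤ) (G : ℕ → W) :
    binomSum ε l (fun i => ((l : ℂ) - i) • G i) = (l : ℂ) • binomSum ε (l - 1) G := by
  simp only [binomSum, smul_finsum, smul_smul]
  refine finsum_congr fun i => ?_
  congr 1
  have h : ((l : ℂ) - i) * (Ring.choose l i : ℤ) = l * (Ring.choose (l - 1) i : ℤ) := by
    exact_mod_cast sub_mul_choose l i
  linear_combination ε ^ i * h

/-- The vacuum has a single nonzero mode, which leaves at most one term in a sum. A negative `k`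
matches no index, in agreement with `intChoose`. -/
theorem binomSum_single {ε : ℂ} (l k : ℤ) (x : W) :
    binomSum ε l (fun i => if (i : ℤ) = k then x else 0) = (ε ^ k * intChoose l k) • x := by
  rcases lt_or_ge k 0 with hk | hk
  · rw [intChoose_of_neg _ hk]
    have : ∀ i : ℕ, ¬ (i : ℤ) = k := fun i => by omega
    simp [binomSum, this]
  · lift k to ℕ using hk
    rw [binomSum, finsum_eq_single _ k fun i hi => by simp [hi]]
    simp [intChoose_natCast]

theorem binomSum_zero_left (ε : ℂ) (F : ℕ → W) : binomSum ε 0 F = F 0 := by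
  rw [binomSum, finsum_eq_single _ 0 fun i hi => by
    rw [Ring.choose_zero_pos ℤ (Nat.pos_of_ne_zero hi)]; simp]
  simp

/-- These signs turn the `m = -1` sum of the Jacobi identity into the alternating series of skew
symmetry. -/
theorem choose_neg_one (i : ℕ) : Ring.choose (-1 : ℤ) i = (-1) ^ i := by
  rw [Ring.choose_neg, show (1 : ℤ) + i - 1 = i by ring, Ring.choose_natCast, Nat.choose_self,
    Units.smul_def, Int.coe_negOnePow_natCast]
  simp

/-- Vandermonde's identity. -/
theorem binomSum_intChoose_smul (m s k : ℤ) (x : W) :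
    binomSum 1 m (fun i => (intChoose s (k - i) : ℂ) • x) = (intChoose (m + s) k : ℂ) • x := by
  rcases lt_or_ge k 0 with hk | hk
  · have : ∀ i : ℕ, intChoose s (k - i) = 0 := fun i => intChoose_of_neg _ (by omega)
    simp [binomSum, this, intChoose_of_neg _ hk]
  · lift k to ℕ using hk
    rw [binomSum_eq_sum_range 1 m (N := k + 1) fun i hi => by
      rw [intChoose_of_neg _ (by omega)]; simp]
    simp only [smul_smul, ← Finset.sum_smul]
    congr 1
    rw [intChoose_natCast, Ring.add_choose_eq k (Commute.all m s),
      Finset.Nat.sum_antidiagonal_eq_sum_range_succ_mk]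
    push_cast
    refine Finset.sum_congr rfl fun i hi => ?_
    rw [← Nat.cast_sub (Nat.lt_succ_iff.mp (Finset.mem_range.mp hi)), intChoose_natCast]
    simp

end BinomialSums

/-! ### Recursions for the Jacobi defect -/

section Borcherds

variable {W : Type*} [AddCommGroup W] [Module ℂ W]

/-- The difference of the two sides of the Jacobi identity at `(l, m, n)`, where `f p q`, `g q p`
and `h k p` stand for `u_p v_q w`, `v_q u_p w` and `(u_k v)_p w`. -/
noncomputable def jacobiDefect (f g h : ℤ → ℤ → W) (l m n : ℤ) : W :=
  binomSum (-1) l (fun i => f (m + l - i) (n + i)) -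
    (-1 : ℂ) ^ l • binomSum (-1) l (fun i => g (n + l - i) (m + i)) -
    binomSum 1 m (fun i => h (l + i) (m + n - i))

theorem eventually_add_natCast {P : ℤ → Prop} {N : ℤ} (hP : ∀ k ≥ N, P k) (n : ℤ) :
    ∀ᶠ i : ℕ in atTop, P (n + i) :=
  eventually_atTop.mpr ⟨(N - n).toNat, fun i hi => hP _ (by omega)⟩

variable {f g h : ℤ → ℤ → W}

/-- Each delta function allows `x₀` to be replaced by `x₁ - x₂`. In coefficients this is Pascal's
rule, for `l + 1` in the first two sums and for `m + 1` in the third. -/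
theorem jacobiDefect_succ {N : ℤ} (hf : ∀ p, ∀ q ≥ N, f p q = 0) (hg : ∀ p, ∀ q ≥ N, g p q = 0)
    (hh : ∀ p ≥ N, ∀ q, h p q = 0) (l m n : ℤ) :
    jacobiDefect f g h (l + 1) m n = jacobiDefect f g h l (m + 1) n -
      jacobiDefect f g h l m (n + 1) := by
  have ef : ∀ a n : ℤ, ∀ᶠ i : ℕ in atTop, f (a - i) (n + i) = 0 := fun a n =>
    (eventually_add_natCast (P := fun q => ∀ p, f p q = 0) (fun k hk p => hf p k hk) n).mono
      fun i hi => hi _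
  have eg : ∀ a n : ℤ, ∀ᶠ i : ℕ in atTop, g (a - i) (n + i) = 0 := fun a n =>
    (eventually_add_natCast (P := fun q => ∀ p, g p q = 0) (fun k hk p => hg p k hk) n).mono
      fun i hi => hi _
  have eh : ∀ a n : ℤ, ∀ᶠ i : ℕ in atTop, h (n + i) (a - i) = 0 := fun a n =>
    (eventually_add_natCast (P := fun p => ∀ q, h p q = 0) (fun k hk p => hh k hk p) n).mono
      fun i hi => hi _
  unfold jacobiDefect
  rw [binomSum_succ _ _ (ef _ _), binomSum_succ _ _ (eg _ _), binomSum_succ _ m (eh _ _),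
    zpow_add_one₀ (by norm_num)]
  simp only [Nat.cast_add, Nat.cast_one]
  simp only [show ∀ i : ℕ, m + (l + 1) - (i : ℤ) = m + 1 + l - i from fun i => by ring,
    show ∀ i : ℕ, n + (l + 1) - (i : ℤ) = n + 1 + l - i from fun i => by ring,
    show ∀ i : ℕ, n + ((i : ℤ) + 1) = n + 1 + i from fun i => by ring,
    show ∀ i : ℕ, m + ((i : ℤ) + 1) = m + 1 + i from fun i => by ring,
    show ∀ i : ℕ, l + ((i : ℤ) + 1) = l + 1 + i from fun i => by ring,
    show ∀ i : ℕ, m + (l + 1) - ((i : ℤ) + 1) = m + l - i from fun i => by ring,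
    show ∀ i : ℕ, n + (l + 1) - ((i : ℤ) + 1) = n + l - i from fun i => by ring,
    show ∀ i : ℕ, m + (n + 1) - (i : ℤ) = m + 1 + n - i from fun i => by ring,
    show ∀ i : ℕ, m + 1 + n - ((i : ℤ) + 1) = m + n - i from fun i => by ring]
  module

/-- `∂₁ + ∂₂` annihilates `(x₁ - x₂)^l`: the surplus terms with factors `l - i` and `i` cancel after
an index shift, as `(i + 1) C(l, i + 1) = (l - i) C(l, i)` and `ε = -1`. -/
theorem map_binomSum_derivation (D : Module.End ℂ W) {N : ℤ} (hf : ∀ p, ∀ q ≥ N, f p q = 0)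
    (hDf : ∀ p q : ℤ, D (f p q) = -((p : ℂ) • f (p - 1) q + (q : ℂ) • f p (q - 1)))
    (l m n : ℤ) :
    D (binomSum (-1) l (fun i => f (m + l - i) (n + i))) =
      -((m : ℂ) • binomSum (-1) l (fun i => f (m - 1 + l - i) (n + i)) +
        (n : ℂ) • binomSum (-1) l (fun i => f (m + l - i) (n - 1 + i))) := by
  have ef : ∀ a n : ℤ, ∀ᶠ i : ℕ in atTop, f (a - i) (n + i) = 0 := fun a n =>
    (eventually_add_natCast (P := fun q => ∀ p, f p q = 0) (fun k hk p => hf p k hk) n).mono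
      fun i hi => hi _
  have key := binomSum_natCast_smul (-1) l (ef (m + l) (n - 1))
  have e1 : ∀ i : ℕ, D (f (m + l - i) (n + i)) = (-1 : ℂ) •
      (((m : ℂ) • f (m - 1 + l - i) (n + i) + (n : ℂ) • f (m + l - i) (n - 1 + i)) +
      (((l : ℂ) - i) • f (m - 1 + l - i) (n + i) + (i : ℂ) • f (m + l - i) (n - 1 + i))) := by
    intro i
    rw [hDf, show m + l - (i : ℤ) - 1 = m - 1 + l - i by ring,
      show n + (i : ℤ) - 1 = n - 1 + i by ring]
    push_cast
    module
  have s1 : ∀ c : ℕ → ℂ, ∀ᶠ i : ℕ in atTop, c i • f (m - 1 + l - i) (n + i) = 0 := fun c =>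
    (ef (m - 1 + l) n).mono fun i hi => by rw [hi, smul_zero]
  have s2 : ∀ c : ℕ → ℂ, ∀ᶠ i : ℕ in atTop, c i • f (m + l - i) (n - 1 + i) = 0 := fun c =>
    (ef (m + l) (n - 1)).mono fun i hi => by rw [hi, smul_zero]
  have s3 : ∀ c d : ℕ → ℂ, ∀ᶠ i : ℕ in atTop,
      c i • f (m - 1 + l - i) (n + i) + d i • f (m + l - i) (n - 1 + i) = 0 := fun c d =>
    ((s1 c).and (s2 d)).mono fun i hi => by rw [hi.1, hi.2, add_zero]
  rw [map_binomSum D _ _ (ef _ _)]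
  simp only [e1]
  rw [binomSum_smul, binomSum_add _ _ (s3 (fun _ => m) fun _ => n) (s3 (fun i => l - i) fun i => i),
    binomSum_add _ _ (s1 fun _ => m) (s2 fun _ => n),
    binomSum_add _ _ (s1 fun i => l - i) (s2 fun i => i), key]
  simp only [Nat.cast_add, Nat.cast_one,
    show ∀ i : ℕ, n - 1 + ((i : ℤ) + 1) = n + i from fun i => by ring,
    show ∀ i : ℕ, m + l - ((i : ℤ) + 1) = m - 1 + l - i from fun i => by ring, binomSum_smul]
  module

theorem map_jacobiDefect (D : Module.End ℂ W) {N : ℤ} (hf : ∀ p, ∀ q ≥ N, f p q = 0)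
    (hg : ∀ p, ∀ q ≥ N, g p q = 0) (hh : ∀ p ≥ N, ∀ q, h p q = 0)
    (hDf : ∀ p q : ℤ, D (f p q) = -((p : ℂ) • f (p - 1) q + (q : ℂ) • f p (q - 1)))
    (hDg : ∀ p q : ℤ, D (g p q) = -((p : ℂ) • g (p - 1) q + (q : ℂ) • g p (q - 1)))
    (hDh : ∀ k q : ℤ, D (h k q) = -((q : ℂ) • h k (q - 1))) (l m n : ℤ) :
    D (jacobiDefect f g h l m n) = -((m : ℂ) • jacobiDefect f g h l (m - 1) n +
      (n : ℂ) • jacobiDefect f g h l m (n - 1)) := by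
  have eh : ∀ a n : ℤ, ∀ᶠ i : ℕ in atTop, h (n + i) (a - i) = 0 := fun a n =>
    (eventually_add_natCast (P := fun p => ∀ q, h p q = 0) (fun k hk p => hh k hk p) n).mono
      fun i hi => hi _
  have e1 : ∀ i : ℕ, D (h (l + i) (m + n - i)) = (-1 : ℂ) •
      (((m : ℂ) - i) • h (l + i) (m - 1 + n - i) + (n : ℂ) • h (l + i) (m - 1 + n - i)) := by
    intro i
    rw [hDh, show m + n - (i : ℤ) - 1 = m - 1 + n - i by ring]
    push_cast
    module
  have s1 : ∀ c : ℕ → ℂ, ∀ᶠ i : ℕ in atTop, c i • h (l + i) (m - 1 + n - i) = 0 := fun c =>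
    (eh (m - 1 + n) l).mono fun i hi => by rw [hi, smul_zero]
  have e2 : D (binomSum 1 m (fun i => h (l + i) (m + n - i))) =
      -((m : ℂ) • binomSum 1 (m - 1) (fun i => h (l + i) (m - 1 + n - i)) +
        (n : ℂ) • binomSum 1 m (fun i => h (l + i) (m + (n - 1) - i))) := by
    rw [map_binomSum D _ _ (eh _ _)]
    simp only [e1]
    rw [binomSum_smul, binomSum_add _ _ (s1 fun i => m - i) (s1 fun _ => n), binomSum_sub_smul,
      binomSum_smul, show m + (n - 1) = m - 1 + n by ring]
    module
  unfold jacobiDefect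
  rw [map_sub, map_sub, map_smul, map_binomSum_derivation D hf hDf,
    map_binomSum_derivation D hg hDg, e2]
  module

/-- A Jacobi identity in which one regular vector (such as the vacuum) is acted upon follows from
skew symmetry and the compatibility of the modes with a derivation. -/
theorem jacobiDefect_eq_zero (D : Module.End ℂ W) {N : ℤ} (hf : ∀ p, ∀ q ≥ 0, f p q = 0)
    (hg : ∀ p, ∀ q ≥ 0, g p q = 0) (hh : ∀ p, ∀ q ≥ 0, h p q = 0) (hhN : ∀ p ≥ N, ∀ q, h p q = 0)
    (hDf : ∀ p q : ℤ, D (f p q) = -((p : ℂ) • f (p - 1) q + (q : ℂ) • f p (q - 1)))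
    (hDg : ∀ p q : ℤ, D (g p q) = -((p : ℂ) • g (p - 1) q + (q : ℂ) • g p (q - 1)))
    (hDh : ∀ k q : ℤ, D (h k q) = -((q : ℂ) • h k (q - 1)))
    (hfh : ∀ p, f p (-1) = h p (-1))
    (hgh : ∀ l, (-1 : ℂ) ^ l • g l (-1) = -binomSum 1 (-1) (fun i => h (l + i) (-1 - i)))
    (l m n : ℤ) : jacobiDefect f g h l m n = 0 := by
  have succ := fun l m n => jacobiDefect_succ (N := max 0 N) (fun p q hq => hf p q (by omega))
    (fun p q hq => hg p q (by omega)) (fun p hp q => hhN p (by omega) q) l m n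
  have deriv := fun l m n => map_jacobiDefect D (N := max 0 N) (fun p q hq => hf p q (by omega))
    (fun p q hq => hg p q (by omega)) (fun p hp q => hhN p (by omega) q) hDf hDg hDh l m n
  have hf0 : ∀ l m : ℤ, binomSum (-1) l (fun i => f (m + l - i) (0 + i)) = 0 := fun l m => by
    simp only [binomSum]
    exact finsum_eq_zero_of_forall_eq_zero fun i => by rw [hf _ _ (by omega), smul_zero]
  -- Here every term vanishes; in the third sum `m - i` is nonnegative unless `C(m, i) = 0`.
  have nonneg0 : ∀ l m : ℤ, 0 ≤ m → jacobiDefect f g h l m 0 = 0 := by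
    intro l m hm
    lift m to ℕ using hm
    have h1 : binomSum (-1) l (fun i => g (0 + l - i) ((m : ℤ) + i)) = 0 := by
      simp only [binomSum]
      exact finsum_eq_zero_of_forall_eq_zero fun i => by rw [hg _ _ (by omega), smul_zero]
    have h2 : binomSum 1 m (fun i => h (l + i) ((m : ℤ) + 0 - i)) = 0 := by
      simp only [binomSum]
      refine finsum_eq_zero_of_forall_eq_zero fun i => ?_
      rcases le_or_gt i m with hi | hi
      · rw [hh _ _ (by omega), smul_zero]
      · rw [Ring.choose_natCast, Nat.choose_eq_zero_of_lt hi]; simp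
    rw [jacobiDefect, hf0, h1, h2]
    simp
  -- At `m = -1` this is `hgh`. At `n = 0` the derivation rule has only the term with factor `m`,
  -- which is nonzero for `m < 0`, so `m` can be lowered.
  have neg0 : ∀ (j : ℕ) (l : ℤ), jacobiDefect f g h l (-1 - j) 0 = 0 := by
    intro j
    induction j with
    | zero =>
      intro l
      have h1 : binomSum (-1) l (fun i => g (0 + l - i) (-1 + i)) = g l (-1) := by
        rw [binomSum, finsum_eq_single _ 0 fun i hi => by rw [hg _ _ (by omega), smul_zero]]
        simp
      rw [Nat.cast_zero, sub_zero, jacobiDefect, hf0, h1, hgh]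
      simp
    | succ j ih =>
      intro l
      have h1 := deriv l (-1 - j) 0
      rw [ih, map_zero, Int.cast_zero, zero_smul, add_zero, zero_eq_neg] at h1
      rw [show (-1 : ℤ) - (j + 1 : ℕ) = -1 - j - 1 by push_cast; ring]
      refine (smul_eq_zero.mp h1).resolve_left ?_
      exact_mod_cast (show (-1 : ℤ) - j ≠ 0 by omega)
  have at0 : ∀ l m : ℤ, jacobiDefect f g h l m 0 = 0 := by
    intro l m
    rcases le_or_gt 0 m with hm | hm
    · exact nonneg0 l m hm
    · obtain ⟨j, rfl⟩ : ∃ j : ℕ, m = -1 - j := ⟨(-1 - m).toNat, by omega⟩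
      exact neg0 j l
  -- At `n = -1` the defect depends only on `l + m`, so `m = 0` suffices, where it is `hfh`.
  have shift : ∀ l m : ℤ, jacobiDefect f g h (l + 1) m (-1) = jacobiDefect f g h l (m + 1) (-1) :=
    fun l m => by rw [succ, show (-1 : ℤ) + 1 = 0 by rfl, at0, sub_zero]
  have atneg1 : ∀ l m : ℤ, jacobiDefect f g h l m (-1) = 0 := by
    intro l m
    induction m using Int.induction_on generalizing l with
    | zero =>
      have h1 : binomSum (-1) l (fun i => f (0 + l - i) (-1 + i)) = f l (-1) := by
        rw [binomSum, finsum_eq_single _ 0 fun i hi => by rw [hf _ _ (by omega), smul_zero]]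
        simp
      have h2 : binomSum (-1) l (fun i => g (-1 + l - i) (0 + i)) = 0 := by
        simp only [binomSum]
        exact finsum_eq_zero_of_forall_eq_zero fun i => by rw [hg _ _ (by omega), smul_zero]
      rw [jacobiDefect, h1, h2, binomSum_zero_left, hfh]
      simp
    | succ m ih => rw [← shift, ih]
    | pred m ih => rw [← sub_add_cancel l 1, shift, sub_add_cancel, ih]
  -- The recursion in `l` raises `n` from `0`; the derivation rule lowers `n` from `-1`, its factor
  -- `n` being nonzero there.
  rcases le_or_gt 0 n with hn | hn
  · induction n, hn using Int.leInduction generalizing l m with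
    | base => exact at0 l m
    | succ n hn ih =>
      have := succ l m n
      rw [ih, ih, zero_sub, zero_eq_neg] at this
      exact this
  · obtain ⟨j, rfl⟩ : ∃ j : ℕ, n = -1 - j := ⟨(-1 - n).toNat, by omega⟩
    clear hn
    induction j generalizing l m with
    | zero => simpa using atneg1 l m
    | succ j ih =>
      have h1 := deriv l m (-1 - j)
      rw [ih, ih, map_zero, smul_zero, zero_add, zero_eq_neg] at h1
      rw [show (-1 : ℤ) - (j + 1 : ℕ) = -1 - j - 1 by push_cast; ring]
      refine (smul_eq_zero.mp h1).resolve_left ?_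
      exact_mod_cast (show (-1 : ℤ) - j ≠ 0 by omega)

end Borcherds

/-! ### Truncation conditions that keep the sums finite -/

section Truncation

variable {W : Type*} [AddCommGroup W]

/-- `f p q` vanishes for all sufficiently large `q`, uniformly in `p`. -/
def TruncatesRight (f : ℤ → ℤ → W) : Prop := ∃ N : ℤ, ∀ q ≥ N, ∀ p, f p q = 0

/-- `h p q` vanishes for all sufficiently large `p`, uniformly in `q`. -/
def TruncatesLeft (h : ℤ → ℤ → W) : Prop := ∃ N : ℤ, ∀ p ≥ N, ∀ q, h p q = 0

theorem TruncatesRight.eventually {f : ℤ → ℤ → W} (hf : TruncatesRight f) (a n : ℤ) :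
    ∀ᶠ i : ℕ in atTop, f (a - i) (n + i) = 0 := by
  obtain ⟨N, hN⟩ := hf
  exact (eventually_add_natCast (P := fun q => ∀ p, f p q = 0) hN n).mono fun i hi => hi _

theorem TruncatesLeft.eventually {h : ℤ → ℤ → W} (hh : TruncatesLeft h) (a n : ℤ) :
    ∀ᶠ i : ℕ in atTop, h (n + i) (a - i) = 0 := by
  obtain ⟨N, hN⟩ := hh
  exact (eventually_add_natCast (P := fun q => ∀ p, h q p = 0) hN n).mono fun i hi => hi _

theorem TruncatesRight.add {f f' : ℤ → ℤ → W} (hf : TruncatesRight f) (hf' : TruncatesRight f') :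
    TruncatesRight (fun p q => f p q + f' p q) := by
  obtain ⟨N, hN⟩ := hf
  obtain ⟨N', hN'⟩ := hf'
  exact ⟨max N N', fun q hq p => by
    simp only [hN q (le_of_max_le_left hq), hN' q (le_of_max_le_right hq), add_zero]⟩

theorem TruncatesLeft.add {h h' : ℤ → ℤ → W} (hh : TruncatesLeft h) (hh' : TruncatesLeft h') :
    TruncatesLeft (fun p q => h p q + h' p q) := by
  obtain ⟨N, hN⟩ := hh
  obtain ⟨N', hN'⟩ := hh'
  exact ⟨max N N', fun q hq p => by
    simp only [hN q (le_of_max_le_left hq), hN' q (le_of_max_le_right hq), add_zero]⟩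

end Truncation

/-! ### Linearity of the Jacobi defect -/

section Defect

variable {W : Type*} [AddCommGroup W] [Module ℂ W]

theorem jacobiDefect_add {f f' g g' h h' : ℤ → ℤ → W} (hf : TruncatesRight f)
    (hf' : TruncatesRight f') (hg : TruncatesRight g) (hg' : TruncatesRight g')
    (hh : TruncatesLeft h) (hh' : TruncatesLeft h') (l m n : ℤ) :
    jacobiDefect (fun p q => f p q + f' p q) (fun p q => g p q + g' p q)
      (fun p q => h p q + h' p q) l m n =
    jacobiDefect f g h l m n + jacobiDefect f' g' h' l m n := by
  unfold jacobiDefect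
  rw [binomSum_add _ _ (hf.eventually _ _) (hf'.eventually _ _),
    binomSum_add _ _ (hg.eventually _ _) (hg'.eventually _ _),
    binomSum_add _ _ (hh.eventually _ _) (hh'.eventually _ _)]
  module

theorem jacobiDefect_smul (c : ℂ) (f g h : ℤ → ℤ → W) (l m n : ℤ) :
    jacobiDefect (fun p q => c • f p q) (fun p q => c • g p q) (fun p q => c • h p q) l m n =
      c • jacobiDefect f g h l m n := by
  unfold jacobiDefect
  simp only [binomSum_smul]
  module

theorem map_jacobiDefect_apply {W' : Type*} [AddCommGroup W'] [Module ℂ W'] (φ : W →ₗ[ℂ] W')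
    {f g h : ℤ → ℤ → W} (hf : TruncatesRight f) (hg : TruncatesRight g) (hh : TruncatesLeft h)
    (l m n : ℤ) :
    φ (jacobiDefect f g h l m n) =
      jacobiDefect (fun p q => φ (f p q)) (fun p q => φ (g p q)) (fun p q => φ (h p q)) l m n := by
  unfold jacobiDefect
  rw [map_sub, map_sub, map_smul, map_binomSum _ _ _ (hf.eventually _ _),
    map_binomSum _ _ _ (hg.eventually _ _), map_binomSum _ _ _ (hh.eventually _ _)]

end Defect

/-! ### Modes, and the Jacobi identity with a vacuum operator -/

section Modes

variable {V W : Type*} [AddCommGroup V] [Module ℂ V] [AddCommGroup W] [Module ℂ W]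

theorem mode_add (YW : V →ₗ[ℂ] VertexOperator ℂ W) (u v : V) (n : ℤ) (w : W) :
    mode YW (u + v) n w = mode YW u n w + mode YW v n w := by simp [mode]

theorem mode_smul (YW : V →ₗ[ℂ] VertexOperator ℂ W) (c : ℂ) (u : V) (n : ℤ) (w : W) :
    mode YW (c • u) n w = c • mode YW u n w := by simp [mode]

theorem mode_zero (YW : V →ₗ[ℂ] VertexOperator ℂ W) (n : ℤ) (w : W) :
    mode YW 0 n w = 0 := by simp [mode]

theorem exists_mode_eq_zero (YW : V →ₗ[ℂ] VertexOperator ℂ W) (u : V) (w : W) :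
    ∃ N : ℤ, ∀ n ≥ N, mode YW u n w = 0 :=
  ⟨-HahnSeries.order ((HahnModule.of ℂ).symm (YW u w)), fun n hn =>
    VertexOperator.ncoeff_eq_zero_of_lt_order _ _ _ (by omega)⟩

theorem vertexOperator_ext {A B : VertexOperator ℂ W}
    (h : ∀ (n : ℤ) (w : W), VertexOperator.ncoeff A n w = VertexOperator.ncoeff B n w) :
    A = B := by
  apply HVertexOperator.coeff_inj
  funext n
  ext w
  simpa using h (-n - 1) w

theorem truncatesRight_mode (YW : V →ₗ[ℂ] VertexOperator ℂ W) (u v : V) (w : W) :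
    TruncatesRight (fun p q => mode YW u p (mode YW v q w)) := by
  obtain ⟨N, hN⟩ := exists_mode_eq_zero YW v w
  exact ⟨N, fun q hq p => by simp only [hN q hq, map_zero]⟩

theorem truncatesLeft_mode (Y : V →ₗ[ℂ] VertexOperator ℂ V) (YW : V →ₗ[ℂ] VertexOperator ℂ W)
    (u v : V) (w : W) : TruncatesLeft (fun p q => mode YW (mode Y u p v) q w) := by
  obtain ⟨N, hN⟩ := exists_mode_eq_zero Y u v
  exact ⟨N, fun q hq p => by simp only [hN q hq, mode_zero]⟩

/-- The Jacobi identity for the vectors `u`, `v`, `w`. -/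
def JacobiFor (Y : V →ₗ[ℂ] VertexOperator ℂ V) (YW : V →ₗ[ℂ] VertexOperator ℂ W) (u v : V)
    (w : W) : Prop :=
  ∀ l m n : ℤ, jacobiDefect (fun p q => mode YW u p (mode YW v q w))
    (fun q p => mode YW v q (mode YW u p w)) (fun k p => mode YW (mode Y u k v) p w) l m n = 0

theorem jacobiIdentity_iff (Y : V →ₗ[ℂ] VertexOperator ℂ V) (YW : V →ₗ[ℂ] VertexOperator ℂ W) :
    JacobiIdentity Y YW ↔ ∀ u v w, JacobiFor Y YW u v w := by
  refine forall₃_congr fun u v w => forall₃_congr fun l m n => ?_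
  rw [jacobiDefect, sub_eq_zero]
  simp only [binomSum, smul_finsum, one_pow, one_mul, zpow_add₀ (show (-1 : ℂ) ≠ 0 by norm_num), zpow_natCast,
    mul_assoc, smul_smul]

variable {Y : V →ₗ[ℂ] VertexOperator ℂ V} {YW : V →ₗ[ℂ] VertexOperator ℂ W}

theorem JacobiFor.add_smul_left {u u' v : V} {w : W} (h : JacobiFor Y YW u v w)
    (h' : JacobiFor Y YW u' v w) (c : ℂ) : JacobiFor Y YW (u + c • u') v w := by
  intro l m n
  have t1 := truncatesRight_mode YW (c • u') v w
  have t2 := truncatesRight_mode YW v (c • u') w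
  have t3 := truncatesLeft_mode Y YW (c • u') v w
  simp only [mode_smul, map_smul] at t1 t2 t3
  simp only [mode_add, mode_smul, map_add, map_smul]
  rw [jacobiDefect_add (truncatesRight_mode YW u v w) t1 (truncatesRight_mode YW v u w) t2
    (truncatesLeft_mode Y YW u v w) t3, jacobiDefect_smul, h, h', smul_zero, add_zero]

theorem JacobiFor.add_smul_right {u v v' : V} {w : W} (h : JacobiFor Y YW u v w)
    (h' : JacobiFor Y YW u v' w) (c : ℂ) : JacobiFor Y YW u (v + c • v') w := by
  intro l m n
  have t1 := truncatesRight_mode YW u (c • v') w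
  have t2 := truncatesRight_mode YW (c • v') u w
  have t3 := truncatesLeft_mode Y YW u (c • v') w
  simp only [mode_smul, map_smul] at t1 t2 t3
  simp only [mode_add, mode_smul, map_add, map_smul]
  rw [jacobiDefect_add (truncatesRight_mode YW u v w) t1 (truncatesRight_mode YW v u w) t2
    (truncatesLeft_mode Y YW u v w) t3, jacobiDefect_smul, h, h', smul_zero, add_zero]

/-- The Jacobi identity holds when the first vector acts as the vacuum. -/
theorem jacobiFor_vacuum_left {one : V} (hY : ∀ v n, mode Y one n v = if n = -1 then v else 0)
    (hYW : ∀ w n, mode YW one n w = if n = -1 then w else 0) (v : V) (w : W) :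
    JacobiFor Y YW one v w := by
  intro l m n
  unfold jacobiDefect
  have e1 : ∀ i : ℕ, mode YW one (m + l - i) (mode YW v (n + i) w) =
      if (i : ℤ) = m + l + 1 then mode YW v (m + n + l + 1) w else 0 := fun i => by
    rw [hYW]
    split_ifs <;> first | omega | rfl | (congr 2; omega)
  have e2 : ∀ i : ℕ, mode YW v (n + l - i) (mode YW one (m + i) w) =
      if (i : ℤ) = -1 - m then mode YW v (m + n + l + 1) w else 0 := fun i => by
    rw [hYW]
    split_ifs <;> first | omega | exact map_zero _ | (congr 2; omega)
  have e3 : ∀ i : ℕ, mode YW (mode Y one (l + i) v) (m + n - i) w =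
      if (i : ℤ) = -l - 1 then mode YW v (m + n + l + 1) w else 0 := fun i => by
    rw [hY]
    split_ifs <;> first | omega | exact mode_zero _ _ _ | (congr 2; omega)
  simp only [e1, e2, e3, binomSum_single, smul_smul, ← sub_smul, one_zpow, one_mul]
  rw [intChoose_delta, sub_self, zero_smul]

/-- The Jacobi identity holds when the second vector acts as the vacuum, provided that the
coefficients of `Y(Y(u, x₀)1, x₂)` are those of `Y(u, x₂ + x₀)`. -/
theorem jacobiFor_vacuum_right {one u : V} (w : W)
    (hYW : ∀ w n, mode YW one n w = if n = -1 then w else 0)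
    (hu : ∀ k p : ℤ, mode YW (mode Y u k one) p w =
      ((-1 : ℂ) ^ (-k - 1) * intChoose p (-k - 1)) • mode YW u (p + k + 1) w) :
    JacobiFor Y YW u one w := by
  intro l m n
  unfold jacobiDefect
  have e1 : ∀ i : ℕ, mode YW one (n + l - i) (mode YW u (m + i) w) =
      if (i : ℤ) = n + l + 1 then mode YW u (m + n + l + 1) w else 0 := fun i => by
    rw [hYW]
    split_ifs <;> first | omega | rfl | (congr 2; omega)
  have e2 : ∀ i : ℕ, mode YW u (m + l - i) (mode YW one (n + i) w) =
      if (i : ℤ) = -1 - n then mode YW u (m + n + l + 1) w else 0 := fun i => by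
    rw [hYW]
    split_ifs <;> first | omega | exact map_zero _ | (congr 2; omega)
  have e3 : ∀ i : ℕ, mode YW (mode Y u (l + i) one) (m + n - i) w =
      (intChoose (-l - m - n - 2) (-l - 1 - i) : ℂ) • mode YW u (m + n + l + 1) w := fun i => by
    rw [hu, intChoose_neg, show -(l + (i : ℤ)) - 1 - (m + n - i) - 1 = -l - m - n - 2 by ring,
      show -(l + (i : ℤ)) - 1 = -l - 1 - i by ring,
      show m + n - (i : ℤ) + (l + i) + 1 = m + n + l + 1 by ring]
  -- Vandermonde sums the third series; the scalar left over is the delta identity at `(l, n)`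
  -- multiplied by a sign.
  simp only [e1, e2, e3, binomSum_single, smul_smul, ← sub_smul, binomSum_intChoose_smul]
  convert zero_smul ℂ _
  have h1 := intChoose_delta l n
  have h2 := intChoose_neg n (-l - 1)
  rw [show -l - 1 - n - 1 = m + (-l - m - n - 2) by ring] at h2
  have hs : (-1 : ℂ) ^ (-l - 1) = -(-1 : ℂ) ^ l := by
    rw [show -l - 1 = l + 2 * (-l) + -1 by ring, zpow_add₀ (by norm_num), zpow_add₀ (by norm_num),
      zpow_mul]
    simp
  rw [hs] at h2
  linear_combination h2 - (-1 : ℂ) ^ l * h1 -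
    (-1 : ℂ) ^ (-1 - n) * intChoose l (-1 - n) * neg_one_zpow_mul_self l

end Modes

/-! ### The series `e^{xD} u` -/

section Exponential

variable {V W : Type*} [AddCommGroup V] [Module ℂ V] [AddCommGroup W] [Module ℂ W]

theorem expMode_of_nonneg (D : Module.End ℂ V) (u : V) {n : ℤ} (hn : 0 ≤ n) :
    expMode D u n = 0 := if_neg (not_lt.mpr hn)

theorem expMode_neg_one_sub (D : Module.End ℂ V) (u : V) (j : ℕ) :
    expMode D u (-1 - j) = (j.factorial : ℂ)⁻¹ • (D ^ j) u := by
  rw [expMode, if_pos (by omega), show (-(-1 - (j : ℤ)) - 1).toNat = j by omega]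

theorem expMode_neg_one (D : Module.End ℂ V) (u : V) : expMode D u (-1) = u := by
  simpa using expMode_neg_one_sub D u 0

theorem expMode_neg_two (D : Module.End ℂ V) (u : V) : expMode D u (-2) = D u := by
  simpa using expMode_neg_one_sub D u 1

theorem exists_eq_neg_one_sub {n : ℤ} (hn : n < 0) : ∃ j : ℕ, n = -1 - j :=
  ⟨(-1 - n).toNat, by omega⟩

theorem expMode_add (D : Module.End ℂ V) (u v : V) (n : ℤ) :
    expMode D (u + v) n = expMode D u n + expMode D v n := by
  unfold expMode
  split_ifs <;> simp

theorem expMode_smul (D : Module.End ℂ V) (c : ℂ) (u : V) (n : ℤ) :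
    expMode D (c • u) n = c • expMode D u n := by
  unfold expMode
  split_ifs
  · rw [map_smul, smul_comm]
  · simp

theorem expMode_zero (D : Module.End ℂ V) (n : ℤ) : expMode D 0 n = 0 := by simp [expMode]

theorem map_expMode (D : Module.End ℂ V) (u : V) (n : ℤ) :
    D (expMode D u n) = (-n : ℂ) • expMode D u (n - 1) := by
  rcases le_or_gt 0 n with hn | hn
  · rw [expMode_of_nonneg D u hn, map_zero]
    rcases hn.eq_or_lt with rfl | hn
    · simp
    · rw [expMode_of_nonneg D u (by omega), smul_zero]
  · obtain ⟨j, rfl⟩ := exists_eq_neg_one_sub hn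
    rw [expMode_neg_one_sub, show (-1 : ℤ) - j - 1 = -1 - (j + 1 : ℕ) by push_cast; ring,
      expMode_neg_one_sub, map_smul, pow_succ', Module.End.mul_apply, smul_smul]
    congr 1
    have h1 : (j.factorial : ℂ) ≠ 0 := by exact_mod_cast j.factorial_ne_zero
    have h2 : (j : ℂ) + 1 ≠ 0 := by exact_mod_cast j.succ_ne_zero
    rw [Nat.factorial_succ]
    push_cast
    field_simp
    ring

theorem expMode_map (D : Module.End ℂ V) (u : V) (n : ℤ) :
    expMode D (D u) n = D (expMode D u n) := by
  unfold expMode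
  split_ifs
  · rw [map_smul, ← Module.End.mul_apply, ← Module.End.mul_apply, ← pow_succ, ← pow_succ']
  · simp

/-- Taylor's formula `Y(e^{x₀D}u, x) = Y(u, x + x₀)`, from iterating the derivative property. -/
theorem mode_expMode {YW : V →ₗ[ℂ] VertexOperator ℂ W} {D : Module.End ℂ V}
    (hD : DDerivative YW D) (u : V) (k p : ℤ) (w : W) :
    mode YW (expMode D u k) p w =
      ((-1 : ℂ) ^ (-k - 1) * intChoose p (-k - 1)) • mode YW u (p + k + 1) w := by
  have aux : ∀ (j : ℕ) (p : ℤ), mode YW ((D ^ j) u) p w =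
      ((-1 : ℂ) ^ j * j.factorial * (Ring.choose p j : ℤ)) • mode YW u (p - j) w := by
    intro j
    induction j with
    | zero => intro p; simp
    | succ j ih =>
      intro p
      rw [pow_succ', Module.End.mul_apply, hD, LinearMap.smul_apply, ih, smul_smul,
        show p - 1 - (j : ℤ) = p - (j + 1 : ℕ) by push_cast; ring]
      congr 1
      have h : ((j : ℂ) + 1) * (Ring.choose p (j + 1) : ℤ) = p * (Ring.choose (p - 1) j : ℤ) := by
        exact_mod_cast (succ_mul_choose_succ p j).trans (sub_mul_choose p j)
      rw [Nat.factorial_succ]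
      push_cast
      linear_combination (-1 : ℂ) ^ j * (j.factorial : ℂ) * h
  rcases le_or_gt 0 k with hk | hk
  · rw [expMode_of_nonneg D u hk, mode_zero, intChoose_of_neg _ (by omega)]
    simp
  · obtain ⟨j, rfl⟩ := exists_eq_neg_one_sub hk
    rw [expMode_neg_one_sub, mode_smul, aux, smul_smul, show -(-1 - (j : ℤ)) - 1 = j by ring,
      show p + (-1 - (j : ℤ)) + 1 = p - j by ring, intChoose_natCast, zpow_natCast]
    congr 1
    have h1 : (j.factorial : ℂ) ≠ 0 := by exact_mod_cast j.factorial_ne_zero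
    field_simp

end Exponential

/-! ### Consequences and instances of skew symmetry -/

section Skew

variable {V : Type*} [AddCommGroup V] [Module ℂ V] {Y : V →ₗ[ℂ] VertexOperator ℂ V}
  {D : Module.End ℂ V}

theorem exists_mode_add_natCast_eq_zero (Y : V →ₗ[ℂ] VertexOperator ℂ V) (u v : V) (n : ℤ) :
    ∃ N : ℕ, ∀ i ≥ N, mode Y u (n + i) v = 0 := by
  obtain ⟨N, hN⟩ := exists_mode_eq_zero Y u v
  exact ⟨(N - n).toNat, fun i hi => hN _ (by omega)⟩

/-- `D` is a derivation of all products. -/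
theorem IsVertexAlgebraWithoutVacuum.map_mode (hV : IsVertexAlgebraWithoutVacuum Y D) (u v : V)
    (n : ℤ) : D (mode Y u n v) = (-n : ℂ) • mode Y u (n - 1) v + mode Y u n (D v) := by
  obtain ⟨N, hN⟩ := exists_mode_add_natCast_eq_zero Y v u (n - 1)
  have e0 : ∀ i ≥ N, mode Y v (n + i) u = 0 := fun i hi => by
    have := hN (i + 1) (by omega)
    rwa [show n - 1 + ((i + 1 : ℕ) : ℤ) = n + i by push_cast; ring] at this
  have hD : ∀ j : ℕ, mode Y (D v) (n + j) u = (-(n + j) : ℂ) • mode Y v (n - 1 + j) u := fun j => by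
    rw [hV.derivative, LinearMap.smul_apply, show n + (j : ℤ) - 1 = n - 1 + j by ring]
    push_cast
    rfl
  rw [hV.skew u v n, hV.skew u v (n - 1), hV.skew u (D v) n,
    finsum_eq_sum_range (N := N) fun i hi => by rw [e0 i hi, map_zero, smul_zero],
    finsum_eq_sum_range (N := N + 1) fun i hi => by rw [hN i (by omega), map_zero, smul_zero],
    finsum_eq_sum_range (N := N + 1) fun i hi => by
      rw [hD, hN i (by omega), smul_zero, map_zero, smul_zero],
    Finset.smul_sum, ← Finset.sum_add_distrib, map_sum, Finset.sum_range_succ']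
  simp only [hD, map_smul]
  -- The two series on the right combine with coefficient `-n + (n + j) = j`; the `j = 0` term drops
  -- out and `j / j!` shifts the series to that of `D (u_n v)`.
  have key : ∀ j : ℕ, (-n : ℂ) • ((-1 : ℂ) ^ (n - 1 + j + 1) * (j.factorial : ℂ)⁻¹) •
        (D ^ j) (mode Y v (n - 1 + j) u) +
      ((-1 : ℂ) ^ (n + j + 1) * (j.factorial : ℂ)⁻¹) • (-(n + j) : ℂ) •
        (D ^ j) (mode Y v (n - 1 + j) u) =
      ((-1 : ℂ) ^ (n + j) * ((j : ℂ) * (j.factorial : ℂ)⁻¹)) • (D ^ j) (mode Y v (n - 1 + j) u) :=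
    fun j => by
      rw [show n - 1 + (j : ℤ) + 1 = n + j by ring, zpow_add_one₀ (by norm_num)]
      module
  simp only [key]
  rw [Nat.cast_zero (R := ℂ), zero_mul, mul_zero, zero_smul, add_zero]
  refine Finset.sum_congr rfl fun j _ => ?_
  rw [show n - 1 + ((j + 1 : ℕ) : ℤ) = n + j by push_cast; ring, pow_succ', Module.End.mul_apply]
  congr 1
  have h1 : (j.factorial : ℂ) ≠ 0 := by exact_mod_cast j.factorial_ne_zero
  have h2 : (j : ℂ) + 1 ≠ 0 := by exact_mod_cast j.succ_ne_zero
  rw [Nat.factorial_succ]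
  push_cast
  rw [← add_assoc]
  field_simp

/-- Skew symmetry for the vectors `u` and `v`. -/
def SkewFor (Y : V →ₗ[ℂ] VertexOperator ℂ V) (D : Module.End ℂ V) (u v : V) : Prop :=
  ∀ n : ℤ, mode Y u n v =
    ∑ᶠ j : ℕ, ((-1 : ℂ) ^ (n + j + 1) * (j.factorial : ℂ)⁻¹) • (D ^ j) (mode Y v (n + j) u)

theorem SkewFor.add_smul_left {u u' v : V} (h : SkewFor Y D u v) (h' : SkewFor Y D u' v) (c : ℂ) :
    SkewFor Y D (u + c • u') v := by
  intro n
  obtain ⟨N, hN⟩ := exists_mode_add_natCast_eq_zero Y v u n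
  obtain ⟨N', hN'⟩ := exists_mode_add_natCast_eq_zero Y v u' n
  simp only [mode_add, mode_smul, map_add, map_smul, h n, h' n]
  rw [finsum_eq_sum_range (N := max N N') fun i hi => by
      rw [hN i (by omega), map_zero, smul_zero],
    finsum_eq_sum_range (N := max N N') fun i hi => by
      rw [hN' i (by omega), map_zero, smul_zero],
    finsum_eq_sum_range (N := max N N') fun i hi => by
      rw [hN i (by omega), hN' i (by omega), map_zero, smul_zero, add_zero, smul_zero],
    Finset.smul_sum, ← Finset.sum_add_distrib]
  refine Finset.sum_congr rfl fun i _ => ?_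
  module

theorem SkewFor.add_smul_right {u v v' : V} (h : SkewFor Y D u v) (h' : SkewFor Y D u v') (c : ℂ) :
    SkewFor Y D u (v + c • v') := by
  intro n
  obtain ⟨N, hN⟩ := exists_mode_add_natCast_eq_zero Y v u n
  obtain ⟨N', hN'⟩ := exists_mode_add_natCast_eq_zero Y v' u n
  simp only [mode_add, mode_smul, map_add, map_smul, h n, h' n]
  rw [finsum_eq_sum_range (N := max N N') fun i hi => by
      rw [hN i (by omega), map_zero, smul_zero],
    finsum_eq_sum_range (N := max N N') fun i hi => by
      rw [hN' i (by omega), map_zero, smul_zero],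
    finsum_eq_sum_range (N := max N N') fun i hi => by
      rw [hN i (by omega), hN' i (by omega), map_zero, smul_zero, add_zero, smul_zero],
    Finset.smul_sum, ← Finset.sum_add_distrib]
  refine Finset.sum_congr rfl fun i _ => ?_
  module

variable {one : V}

theorem skewFor_vacuum_right (hY : ∀ v n, mode Y one n v = if n = -1 then v else 0) {u : V}
    (hu : ∀ n, mode Y u n one = expMode D u n) : SkewFor Y D u one := by
  intro n
  simp only [hY, hu]
  rcases le_or_gt 0 n with hn | hn
  · rw [expMode_of_nonneg D u hn]
    exact (finsum_eq_zero_of_forall_eq_zero fun j => by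
      rw [if_neg (by omega), map_zero, smul_zero]).symm
  · obtain ⟨k, rfl⟩ := exists_eq_neg_one_sub hn
    rw [finsum_eq_single _ k fun j hj => by rw [if_neg (by omega), map_zero, smul_zero],
      if_pos (by ring), expMode_neg_one_sub, show (-1 : ℤ) - k + k + 1 = 0 by ring]
    simp

theorem skewFor_vacuum_left (hY : ∀ v n, mode Y one n v = if n = -1 then v else 0) {u : V}
    (hu : ∀ n, mode Y u n one = expMode D u n) : SkewFor Y D one u := by
  intro n
  simp only [hY, hu]
  rcases le_or_gt 0 n with hn | hn
  · rw [if_neg (by omega)]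
    exact (finsum_eq_zero_of_forall_eq_zero fun j => by
      rw [expMode_of_nonneg D u (by omega), map_zero, smul_zero]).symm
  · obtain ⟨k, rfl⟩ := exists_eq_neg_one_sub hn
    rw [finsum_eq_sum_range (N := k + 1) fun j hj => by
      rw [expMode_of_nonneg D u (by omega), map_zero, smul_zero]]
    -- This is `e^{xD} e^{-xD} u = u`: the coefficient of `D^k u` is an alternating sum of binomial
    -- coefficients.
    have key : ∀ j ∈ Finset.range (k + 1), ((-1 : ℂ) ^ ((-1 : ℤ) - k + j + 1) *
        (j.factorial : ℂ)⁻¹) • (D ^ j) (expMode D u (-1 - k + j)) =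
        ((-1 : ℂ) ^ k * (k.factorial : ℂ)⁻¹ * ((-1 : ℂ) ^ j * (k.choose j : ℂ))) • (D ^ k) u := by
      intro j hj
      have hjk : j ≤ k := Nat.lt_succ_iff.mp (Finset.mem_range.mp hj)
      rw [show (-1 : ℤ) - k + j = -1 - (k - j : ℕ) by push_cast [hjk]; ring, expMode_neg_one_sub,
        map_smul, ← Module.End.mul_apply, ← pow_add, Nat.add_sub_cancel' hjk, smul_smul,
        Nat.cast_choose ℂ hjk,
        show (-1 : ℤ) - (k - j : ℕ) + 1 = k + j + 2 * (-k) by push_cast [hjk]; ring,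
        zpow_add₀ (by norm_num), zpow_add₀ (by norm_num), zpow_mul, zpow_natCast, zpow_natCast]
      congr 1
      have h1 : (k.factorial : ℂ) ≠ 0 := by exact_mod_cast k.factorial_ne_zero
      have h2 : (j.factorial : ℂ) ≠ 0 := by exact_mod_cast j.factorial_ne_zero
      have h3 : ((k - j).factorial : ℂ) ≠ 0 := by exact_mod_cast (k - j).factorial_ne_zero
      field_simp
      simp
    rw [Finset.sum_congr rfl key, ← Finset.sum_smul, ← Finset.mul_sum]
    have h : ∑ j ∈ Finset.range (k + 1), (-1 : ℂ) ^ j * (k.choose j : ℂ) =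
        if k = 0 then 1 else 0 := by
      exact_mod_cast Int.alternating_sum_range_choose (n := k)
    rw [h]
    rcases k with _ | k
    · simp
    · rw [if_neg (by omega), if_neg (by omega)]
      simp

end Skew

/-! ### The Jacobi identity applied to the vacuum -/

section JacobiOnVacuum

variable {V : Type*} [AddCommGroup V] [Module ℂ V] {Y : V →ₗ[ℂ] VertexOperator ℂ V}
  {D : Module.End ℂ V}

/-- The coefficients of the Jacobi identity for `Y(u, x₁) e^{x₂ D} v`, `Y(v, x₂) e^{x₁ D} u` and
`e^{x₂ D} Y(u, x₀) v`. -/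
theorem IsVertexAlgebraWithoutVacuum.jacobiDefect_expMode (hV : IsVertexAlgebraWithoutVacuum Y D)
    (u v : V) (l m n : ℤ) :
    jacobiDefect (fun p q => mode Y u p (expMode D v q)) (fun q p => mode Y v q (expMode D u p))
      (fun k p => expMode D (mode Y u k v) p) l m n = 0 := by
  obtain ⟨N, hN⟩ := exists_mode_eq_zero Y u v
  have deriv : ∀ (u v : V) (p q : ℤ), D (mode Y u p (expMode D v q)) =
      -((p : ℂ) • mode Y u (p - 1) (expMode D v q) + (q : ℂ) • mode Y u p (expMode D v (q - 1))) :=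
    fun u v p q => by
      rw [hV.map_mode, map_expMode, map_smul]
      module
  refine jacobiDefect_eq_zero (N := N) D ?_ ?_ ?_ ?_ (deriv u v) (deriv v u) ?_ ?_ ?_ l m n
  · exact fun p q hq => by rw [expMode_of_nonneg D v hq, map_zero]
  · exact fun p q hq => by rw [expMode_of_nonneg D u hq, map_zero]
  · exact fun p q hq => expMode_of_nonneg D _ hq
  · exact fun p hp q => by rw [hN p hp, expMode_zero]
  · exact fun k q => by rw [map_expMode, neg_smul]
  · exact fun p => by rw [expMode_neg_one, expMode_neg_one]
  -- The condition at `m = -1`, `n = 0` is exactly skew symmetry for `v_l u`.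
  · intro l
    rw [expMode_neg_one, hV.skew v u l, binomSum, smul_finsum, ← finsum_neg_distrib]
    refine finsum_congr fun i => ?_
    rw [expMode_neg_one_sub, choose_neg_one, smul_smul, smul_smul, ← neg_smul,
      zpow_add_one₀ (by norm_num), zpow_add₀ (by norm_num), zpow_natCast]
    congr 1
    push_cast
    linear_combination (-(-1 : ℂ) ^ i * (i.factorial : ℂ)⁻¹) * neg_one_zpow_mul_self l

end JacobiOnVacuum

/-! ### The vacuum extension and its properties -/

section VacuumExtension

variable {V : Type*} [AddCommGroup V] [Module ℂ V]

/-- The `n`-th mode of the vacuum extension. -/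
noncomputable def extensionMode (Y : V →ₗ[ℂ] VertexOperator ℂ V) (D : Module.End ℂ V) (x : V × ℂ)
    (n : ℤ) : Module.End ℂ (V × ℂ) :=
  LinearMap.inl ℂ V ℂ ∘ₗ (mode Y x.1 n ∘ₗ LinearMap.fst ℂ V ℂ +
    (LinearMap.toSpanSingleton ℂ V (expMode D x.1 n)) ∘ₗ LinearMap.snd ℂ V ℂ) +
    (if n = -1 then x.2 else 0) • LinearMap.id

theorem extensionMode_apply (Y : V →ₗ[ℂ] VertexOperator ℂ V) (D : Module.End ℂ V) (u v : V)
    (a c : ℂ) (n : ℤ) : extensionMode Y D (u, a) n (v, c) =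
      (mode Y u n v + c • expMode D u n, 0) + (if n = -1 then a else 0) • (v, c) := by
  simp only [extensionMode]
  split_ifs <;> simp

theorem bddBelow_support_extensionMode (Y : V →ₗ[ℂ] VertexOperator ℂ V) (D : Module.End ℂ V)
    (x w : V × ℂ) : BddBelow (Function.support fun k : ℤ => extensionMode Y D x (-k - 1) w) := by
  obtain ⟨u, a⟩ := x
  obtain ⟨v, c⟩ := w
  obtain ⟨N, hN⟩ := exists_mode_eq_zero Y u v
  refine ⟨min (-N - 1) (-1), fun k hk => ?_⟩
  by_contra h
  refine hk ?_
  simp only [extensionMode_apply]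
  rw [hN _ (by omega), expMode_of_nonneg D u (by omega), if_neg (by omega)]
  simp

/-- The vertex operator map of the vacuum extension. -/
noncomputable def vacuumExtension (Y : V →ₗ[ℂ] VertexOperator ℂ V) (D : Module.End ℂ V) :
    (V × ℂ) →ₗ[ℂ] VertexOperator ℂ (V × ℂ) where
  toFun x := VertexOperator.of_coeff (fun k => extensionMode Y D x (-k - 1))
    (bddBelow_support_extensionMode Y D x)
  map_add' x y := vertexOperator_ext fun n w => by
    obtain ⟨u, a⟩ := x
    obtain ⟨u', a'⟩ := y
    obtain ⟨v, c⟩ := w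
    simp only [map_add, Pi.add_apply, LinearMap.add_apply, VertexOperator.ncoeff_of_coeff,
      Prod.mk_add_mk, extensionMode_apply, mode_add, expMode_add]
    ext
    · split_ifs <;> (simp; module)
    · split_ifs <;> (simp; try ring)
  map_smul' r x := vertexOperator_ext fun n w => by
    obtain ⟨u, a⟩ := x
    obtain ⟨v, c⟩ := w
    simp only [map_smul, Pi.smul_apply, LinearMap.smul_apply, VertexOperator.ncoeff_of_coeff,
      RingHom.id_apply, Prod.smul_mk, extensionMode_apply, mode_smul, expMode_smul]
    ext
    · split_ifs <;> (simp; module)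
    · split_ifs <;> (simp; try ring)

theorem mode_vacuumExtension (Y : V →ₗ[ℂ] VertexOperator ℂ V) (D : Module.End ℂ V) (x : V × ℂ)
    (n : ℤ) : mode (vacuumExtension Y D) x n = extensionMode Y D x n := by
  change VertexOperator.ncoeff (VertexOperator.of_coeff _
    (bddBelow_support_extensionMode Y D x)) n = _
  rw [VertexOperator.ncoeff_of_coeff, show -(-n - 1) - 1 = n by ring]

theorem isVacuumExtension_vacuumExtension (Y : V →ₗ[ℂ] VertexOperator ℂ V) (D : Module.End ℂ V) :
    IsVacuumExtension Y D (vacuumExtension Y D) where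
  on_one w n := by
    obtain ⟨v, c⟩ := w
    rw [mode_vacuumExtension, extensionMode_apply, mode_zero, expMode_zero]
    split_ifs <;> simp
  on_left u v c n := by
    rw [mode_vacuumExtension, extensionMode_apply]
    simp

variable {Y : V →ₗ[ℂ] VertexOperator ℂ V} {D : Module.End ℂ V}
  {Ybar : (V × ℂ) →ₗ[ℂ] VertexOperator ℂ (V × ℂ)}

theorem mk_eq_add_smul (u : V) (a : ℂ) : ((u, a) : V × ℂ) = (u, 0) + a • (0, 1) := by
  simp

namespace IsVacuumExtension

theorem mode_apply (h : IsVacuumExtension Y D Ybar) (u v : V) (a c : ℂ) (n : ℤ) :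
    mode Ybar (u, a) n (v, c) =
      (mode Y u n v + c • expMode D u n, 0) + (if n = -1 then a else 0) • (v, c) := by
  rw [mk_eq_add_smul u a, mode_add, mode_smul, h.on_one, h.on_left]
  split_ifs <;> simp

theorem eq_vacuumExtension (h : IsVacuumExtension Y D Ybar) : Ybar = vacuumExtension Y D := by
  ext1
  all_goals
    refine LinearMap.ext fun x => vertexOperator_ext fun n w => ?_
  · exact (h.mode_apply x w.1 0 w.2 n).trans
      ((isVacuumExtension_vacuumExtension Y D).mode_apply x w.1 0 w.2 n).symm
  · exact (h.mode_apply 0 w.1 x w.2 n).trans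
      ((isVacuumExtension_vacuumExtension Y D).mode_apply 0 w.1 x w.2 n).symm

theorem canonicalD_apply (h : IsVacuumExtension Y D Ybar) (u : V) (a : ℂ) :
    canonicalD Ybar (0, 1) (u, a) = (D u, 0) := by
  change mode Ybar (u, a) (-2) (0, 1) = _
  rw [h.mode_apply, expMode_neg_two]
  simp

theorem canonicalD_pow_inl (h : IsVacuumExtension Y D Ybar) (j : ℕ) (u : V) :
    (canonicalD Ybar (0, 1) ^ j) (u, 0) = ((D ^ j) u, 0) := by
  induction j with
  | zero => simp
  | succ j ih =>
    rw [pow_succ', pow_succ', Module.End.mul_apply, Module.End.mul_apply, ih, h.canonicalD_apply]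

/-- On `V` the canonical operator is `D`, and it kills `1`, so creation from the vacuum is `e^{x𝒟}`
on all of `V̄`. -/
theorem mode_vacuum (h : IsVacuumExtension Y D Ybar) (x : V × ℂ) (n : ℤ) :
    mode Ybar x n (0, 1) = expMode (canonicalD Ybar (0, 1)) x n := by
  obtain ⟨u, a⟩ := x
  rw [h.mode_apply, map_zero]
  rcases le_or_gt 0 n with hn | hn
  · rw [expMode_of_nonneg _ _ hn, expMode_of_nonneg _ _ hn, if_neg (by omega)]
    simp
  · obtain ⟨j, rfl⟩ := exists_eq_neg_one_sub hn
    rcases j with _ | j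
    · simp [expMode_neg_one]
    · rw [expMode_neg_one_sub, expMode_neg_one_sub, if_neg (by omega),
        pow_succ, pow_succ (canonicalD Ybar (0, 1)), Module.End.mul_apply, Module.End.mul_apply,
        h.canonicalD_apply, h.canonicalD_pow_inl]
      simp

theorem dDerivative (h : IsVacuumExtension Y D Ybar) (hV : IsVertexAlgebraWithoutVacuum Y D) :
    DDerivative Ybar (canonicalD Ybar (0, 1)) := by
  rintro ⟨u, a⟩ n
  refine LinearMap.ext fun ⟨v, c⟩ => ?_
  rw [h.canonicalD_apply, LinearMap.smul_apply, h.mode_apply, h.mode_apply, hV.derivative,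
    expMode_map, map_expMode]
  -- The identity part of the mode `n - 1` is present only for `n = 0`, where the factor `-n`
  -- removes it.
  rcases eq_or_ne n 0 with rfl | hn
  · simp
  · rw [if_neg (show n - 1 ≠ -1 by omega)]
    ext
    · simp
      module
    · simp

theorem jacobiFor_inl (h : IsVacuumExtension Y D Ybar) (hV : IsVertexAlgebraWithoutVacuum Y D)
    (u v : V) (w : V × ℂ) : JacobiFor Ybar Ybar (u, 0) (v, 0) w := by
  intro l m n
  obtain ⟨w, c⟩ := w
  have t1 : TruncatesRight fun p q => c • mode Y u p (expMode D v q) :=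
    ⟨0, fun q hq p => by simp only [expMode_of_nonneg D v hq, map_zero, smul_zero]⟩
  have t2 : TruncatesRight fun q p => c • mode Y v q (expMode D u p) :=
    ⟨0, fun q hq p => by simp only [expMode_of_nonneg D u hq, map_zero, smul_zero]⟩
  have t3 : TruncatesLeft fun k p => c • expMode D (mode Y u k v) p := by
    obtain ⟨N, hN⟩ := exists_mode_eq_zero Y u v
    exact ⟨N, fun q hq p => by simp only [hN q hq, expMode_zero, smul_zero]⟩
  have s1 := truncatesRight_mode Y u v w
  have s2 := truncatesRight_mode Y v u w
  have s3 := truncatesLeft_mode Y Y u v w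
  -- The defect on `w + c1` splits into that of `V` on `w` and `c` times the exponential one.
  have key := jacobiDefect_add s1 t1 s2 t2 s3 t3 l m n
  rw [jacobiDefect_smul, hV.jacobiDefect_expMode, smul_zero, add_zero,
    (jacobiIdentity_iff Y Y).mp hV.jacobi u v w l m n] at key
  have hmap := map_jacobiDefect_apply (LinearMap.inl ℂ V ℂ) (s1.add t1) (s2.add t2) (s3.add t3) l m n
  rw [key, map_zero] at hmap
  simp only [h.on_left, zero_smul, add_zero, map_add, map_smul]
  exact hmap.symm

theorem jacobi (h : IsVacuumExtension Y D Ybar) (hV : IsVertexAlgebraWithoutVacuum Y D) :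
    JacobiIdentity Ybar Ybar := by
  rw [jacobiIdentity_iff]
  rintro ⟨u, a⟩ ⟨v, b⟩ w
  have left := fun y => jacobiFor_vacuum_left (Y := Ybar) (YW := Ybar) h.on_one h.on_one y w
  have right := fun x => jacobiFor_vacuum_right (Y := Ybar) (YW := Ybar) (one := (0, 1)) (u := x) w
    h.on_one fun k p => by rw [h.mode_vacuum, mode_expMode (h.dDerivative hV)]
  rw [mk_eq_add_smul u a]
  refine JacobiFor.add_smul_left ?_ (left _) a
  rw [mk_eq_add_smul v b]
  exact (h.jacobiFor_inl hV u v w).add_smul_right (right _) b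

theorem skewSymmetry (h : IsVacuumExtension Y D Ybar) (hV : IsVertexAlgebraWithoutVacuum Y D) :
    SkewSymmetry Ybar (canonicalD Ybar (0, 1)) := by
  rintro ⟨u, a⟩ ⟨v, b⟩
  change SkewFor _ _ _ _
  rw [mk_eq_add_smul u a]
  refine SkewFor.add_smul_left ?_ (skewFor_vacuum_left h.on_one (h.mode_vacuum _)) a
  rw [mk_eq_add_smul v b]
  refine SkewFor.add_smul_right ?_ (skewFor_vacuum_right h.on_one (h.mode_vacuum _)) b
  intro n
  simp only [h.on_left, h.canonicalD_pow_inl, zero_smul, add_zero]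
  -- An injective map commutes with `finsum` without any check of finite support.
  have hmap := (LinearMap.inl ℂ V ℂ).toAddMonoidHom.map_finsum_of_injective LinearMap.inl_injective
    fun j : ℕ => ((-1 : ℂ) ^ (n + j + 1) * (j.factorial : ℂ)⁻¹) • (D ^ j) (mode Y v (n + j) u)
  rw [← hV.skew u v n] at hmap
  refine hmap.trans (finsum_congr fun j => ?_)
  simp

theorem isVertexAlgebra (h : IsVacuumExtension Y D Ybar) (hV : IsVertexAlgebraWithoutVacuum Y D) :
    IsVertexAlgebra Ybar (0, 1) where
  vacuum := h.on_one
  creation_regular x n hn := by rw [h.mode_vacuum, expMode_of_nonneg _ _ hn]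
  creation_limit x := by rw [h.mode_vacuum, expMode_neg_one]
  jacobi := h.jacobi hV

theorem isVertexAlgebraWithoutVacuum (h : IsVacuumExtension Y D Ybar)
    (hV : IsVertexAlgebraWithoutVacuum Y D) :
    IsVertexAlgebraWithoutVacuum Ybar (canonicalD Ybar (0, 1)) where
  jacobi := h.jacobi hV
  derivative := h.dDerivative hV
  skew := h.skewSymmetry hV

theorem isHom_inl (h : IsVacuumExtension Y D Ybar) :
    IsHomWithoutVacuum Y D Ybar (canonicalD Ybar (0, 1)) (LinearMap.inl ℂ V ℂ) :=
  ⟨fun u => (h.canonicalD_apply u 0).symm, fun u v n => by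
    simp [LinearMap.inl_apply, h.on_left]⟩

theorem isModule_comp_inl (h : IsVacuumExtension Y D Ybar)
    (hV : IsVertexAlgebraWithoutVacuum Y D) :
    IsModuleWithoutVacuum Y D (Ybar ∘ₗ LinearMap.inl ℂ V ℂ) where
  jacobi u v w l m n := by
    have key := h.jacobi hV (u, 0) (v, 0) w l m n
    have e : ∀ k : ℤ, mode Ybar (u, 0) k (v, 0) = (mode Y u k v, 0) := fun k => by
      rw [h.on_left, zero_smul, add_zero]
    simp only [e] at key
    exact key
  derivative u n := by
    have key := h.dDerivative hV (u, 0) n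
    rw [h.canonicalD_apply] at key
    exact key

theorem injective_comp_inl (h : IsVacuumExtension Y D Ybar) :
    Function.Injective (Ybar ∘ₗ LinearMap.inl ℂ V ℂ) := by
  intro u v huv
  have key : mode Ybar (u, 0) (-1) (0, 1) = mode Ybar (v, 0) (-1) (0, 1) :=
    congrArg (fun A => VertexOperator.ncoeff A (-1) (0, 1)) huv
  rw [h.mode_vacuum, h.mode_vacuum, expMode_neg_one, expMode_neg_one] at key
  exact congrArg Prod.fst key

end IsVacuumExtension

end VacuumExtension

end VertexAlg

theorem theorem2p7 {V : Type u} [AddCommGroup V] [Module ℂ V]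
    (Y : V →ₗ[ℂ] VertexOperator ℂ V) (D : Module.End ℂ V)
    (hV : VertexAlg.IsVertexAlgebraWithoutVacuum Y D) :
    (∃! Ybar : (V × ℂ) →ₗ[ℂ] VertexOperator ℂ (V × ℂ), VertexAlg.IsVacuumExtension Y D Ybar) ∧
    (∀ Ybar : (V × ℂ) →ₗ[ℂ] VertexOperator ℂ (V × ℂ), VertexAlg.IsVacuumExtension Y D Ybar →
      VertexAlg.IsVertexAlgebra Ybar (0, 1) ∧
      VertexAlg.IsVertexAlgebraWithoutVacuum Ybar (VertexAlg.canonicalD Ybar (0, 1)) ∧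
      VertexAlg.IsHomWithoutVacuum Y D Ybar (VertexAlg.canonicalD Ybar (0, 1))
        (LinearMap.inl ℂ V ℂ)) ∧
    (∃ (W : Type u) (_ : AddCommGroup W) (_ : Module ℂ W) (YW : V →ₗ[ℂ] VertexOperator ℂ W),
      VertexAlg.IsModuleWithoutVacuum Y D YW ∧ Function.Injective YW) := by
  have hext := VertexAlg.isVacuumExtension_vacuumExtension Y D
  exact ⟨⟨_, hext, fun _ h => h.eq_vacuumExtension⟩,
    fun _ h => ⟨h.isVertexAlgebra hV, h.isVertexAlgebraWithoutVacuum hV, h.isHom_inl⟩,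
    V × ℂ, inferInstance, inferInstance, _, hext.isModule_comp_inl hV, hext.injective_comp_inl⟩
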